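/- For real $n>0$ let $I(n)=\int_0^1 \left(x^n+(1-x)^n\right)^{1/n}\,dx$. Then, as $n\to\infty$ through the real numbers (in particular through the positive integers), $I(n)$ has a full asymptotic expansion $$I(n)\sim \sum_{i\ge 0}\frac{I_i}{n^i},$$ that is, there are real numbers $I_0,I_1,I_2,\dots$ such that, for every integer $N\ge 0$, $I(n)-\sum_{i=0}^{N} I_i n^{-i}=o(n^{-N})$ as $n\to\infty$. Its first coefficients are $$I_0=\frac34,\quad I_1=0,\quad I_2=\frac{\pi^2}{48},\quad I_3=\frac{\zeta(3)}{8},\quad I_4=-\frac{\pi^4}{960},\quad I_5=-\frac{\zeta(3)\,\pi^2}{48},$$ where $\zeta$ is the Riemann zeta function. -/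

import Mathlib

open Filter Asymptotics

/-- The integral `I(n) = ∫₀¹ (xⁿ + (1 - x)ⁿ)^(1/n) dx`, for a real parameter `n`. -/
noncomputable def powerMeanIntegral (n : ℝ) : ℝ :=
  ∫ x in (0 : ℝ)..1, (x ^ n + (1 - x) ^ n) ^ (1 / n)

/-- `f(n) ~ ∑_{i ≥ 0} c i / nⁱ` as `n → ∞` in the sense of Poincaré: for every `N`, the error of the
partial sum up to and including the index `N` is `o(n^(-N))`. -/
def HasAsymptoticExpansion (f : ℝ → ℝ) (c : ℕ → ℝ) : Prop :=
  ∀ N : ℕ, (fun n : ℝ => f n - ∑ i ∈ Finset.range (N + 1), c i / n ^ i)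
    =o[atTop] fun n : ℝ => 1 / n ^ N

open MeasureTheory Set

/-! Put `ε = 1/n`, fold the integral at `1/2` and substitute `x = sigmoid (ε u)`, so that `((1 -
x)/x)ⁿ = exp (-u)`. With `L = log (1 + exp (-u))` and `g(s) = y² (1 - y)`, `y = sigmoid s`, this
gives `I(n) = 3/4 + 2ε ∫₀^∞ (exp (εL) - 1) g(εu) du` (`powerMeanIntegral_eq`). Since `0 ≤ L ≤ exp
(-u)`, the integrand may be expanded in powers of `ε` under the integral sign, which yields the full
expansion (`exists_abs_integral_sub_sum_le`).

The coefficients are integrals of `L ^ j * u ^ k`, which are not evaluated one by one. Up to order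
3, the Taylor coefficients of `g` at `0` are those of `Re exp (-ωs) / 8`, with `ω` a primitive cube
root of unity (`sigmoidCoeff_eq`). So the coefficients needed agree, up to sign and scale, with
those of `∫ (exp (-εL) - 1) Re exp (ωεu) du`, which has a closed form: it reduces to the Beta
integral `B(-ωε, -ω̄ε)`. As `ω + ω̄ = -1` and `ω ω̄ = 1`, the Gamma quotient becomes `∏ (1 + x)/(1 +
x + x²)` over `x = ε/j`, `j ≥ 1`. Each factor is `(1 - x²)/(1 - x³)`, so the logarithm is `-ζ(2)ε² +
ζ(3)ε³ - ζ(4)ε⁴/2 + O(ε⁶)`. Exponentiating and comparing coefficients (`eq_zero_of_abs_sum_le`)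
gives the stated values. -/

/-! ### Taylor remainders and Cauchy products -/

/-- A Taylor bound with a remainder estimate that is uniform on the half line. -/
lemma abs_sub_sum_taylor_le (N : ℕ) :
    ∀ (G : ℕ → ℝ → ℝ) (C : ℝ), (∀ k s, HasDerivAt (G k) (G (k + 1) s) s) →
      (∀ s, 0 ≤ s → |G N s| ≤ C) → ∀ s, 0 ≤ s →
      |G 0 s - ∑ k ∈ Finset.range N, G k 0 / k.factorial * s ^ k| ≤ C * s ^ N := by
  induction N with
  | zero => intro G C _ hb s hs; simpa using hb s hs
  | succ N ih =>
    intro G C hd hb s hs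
    have key := ih (fun k => G (k + 1)) C (fun k s => hd (k + 1) s) hb
    have hder : ∀ x : ℝ, HasDerivAt
        (fun s => G 0 s - ∑ k ∈ Finset.range (N + 1), G k 0 / k.factorial * s ^ k)
        (G 1 x - ∑ k ∈ Finset.range N, G (k + 1) 0 / k.factorial * x ^ k) x := by
      intro x
      refine (hd 0 x).fun_sub ?_
      simp only [Finset.sum_range_succ' _ N]
      have h : HasDerivAt (fun s : ℝ => ∑ k ∈ Finset.range N,
          G (k + 1) 0 / (k + 1).factorial * s ^ (k + 1))
          (∑ k ∈ Finset.range N, G (k + 1) 0 / k.factorial * x ^ k) x := by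
        refine HasDerivAt.fun_sum fun k _ => ?_
        refine ((hasDerivAt_pow (k + 1) x).const_mul _).congr_deriv ?_
        rw [Nat.factorial_succ]
        have := Nat.factorial_ne_zero k
        push_cast
        field_simp
      simpa using h.add_const (G 0 0)
    have hC : 0 ≤ C := (abs_nonneg _).trans (hb 0 le_rfl)
    have hB : ∀ x : ℝ, HasDerivAt (fun x : ℝ => C * x ^ (N + 1)) (C * ((N + 1 : ℕ) * x ^ N)) x :=
      fun x => by simpa using (hasDerivAt_pow (N + 1) x).const_mul C
    -- Compare derivatives: the remainder vanishes at `0`, and by induction its derivative is at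
    -- most `C x ^ N`, hence at most the derivative of `C x ^ (N + 1)`.
    have := image_norm_le_of_norm_deriv_right_le_deriv_boundary (a := 0) (b := s)
      (f := fun s => G 0 s - ∑ k ∈ Finset.range (N + 1), G k 0 / k.factorial * s ^ k)
      (B := fun x => C * x ^ (N + 1))
      (fun x _ => (hder x).continuousAt.continuousWithinAt)
      (fun x _ => (hder x).hasDerivWithinAt)
      (by simp [Finset.sum_range_succ']) hB ?_ (Set.right_mem_Icc.2 hs)
    · simpa using this
    · intro x hx
      rw [Real.norm_eq_abs]
      refine (key x hx.1).trans ?_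
      refine mul_le_mul_of_nonneg_left ?_ hC
      refine le_mul_of_one_le_left (pow_nonneg hx.1 _) ?_
      exact_mod_cast Nat.succ_pos N

/-- Each `a j * ε ^ j` is paired with `g` truncated at order `N - j`, so every error term on the
right has total order `N` in `ε`. -/
lemma mul_sub_sum_cauchy (f g : ℝ) (a b : ℕ → ℝ) (ε : ℝ) (N : ℕ) :
    f * g - ∑ m ∈ Finset.range N, ε ^ m * ∑ j ∈ Finset.range (m + 1), a j * b (m - j) =
      ∑ j ∈ Finset.range N, a j * ε ^ j * (g - ∑ k ∈ Finset.range (N - j), b k * ε ^ k) +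
        (f - ∑ j ∈ Finset.range N, a j * ε ^ j) * g := by
  have h := Finset.sum_range_diag_flip N fun j k => a j * ε ^ j * (b k * ε ^ k)
  have h2 : ∑ m ∈ Finset.range N, ε ^ m * ∑ j ∈ Finset.range (m + 1), a j * b (m - j) =
      ∑ m ∈ Finset.range N, ∑ j ∈ Finset.range (m + 1),
        a j * ε ^ j * (b (m - j) * ε ^ (m - j)) := by
    refine Finset.sum_congr rfl fun m _ => ?_
    rw [Finset.mul_sum]
    refine Finset.sum_congr rfl fun j hj => ?_
    have : j ≤ m := Nat.lt_succ_iff.1 (Finset.mem_range.1 hj)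
    rw [← Nat.add_sub_of_le this, pow_add]
    simp only [Nat.add_sub_cancel_left]
    ring
  rw [h2, h]
  simp only [mul_sub, sub_mul, Finset.sum_sub_distrib, Finset.mul_sum, Finset.sum_mul]
  ring

/-- The exponent `max N 1` keeps a factor `|x|` even for `N = 0`; with `x = σ ε L` this factor
supplies the decay in `u`. -/
lemma abs_exp_sub_one_sub_sum_le {x : ℝ} (hx : |x| ≤ 1) (N : ℕ) :
    |Real.exp x - 1 - ∑ j ∈ Finset.range N, (if j = 0 then 0 else x ^ j / j.factorial)|
      ≤ 2 * |x| ^ max N 1 := by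
  rcases N with _ | N
  · simpa using Real.abs_exp_sub_one_le hx
  · have h := Real.exp_bound hx (Nat.succ_pos N)
    rw [Finset.sum_range_succ'] at h ⊢
    have h1 : max (N + 1) 1 = N + 1 := by simp
    rw [h1]
    simp only [Nat.add_eq_zero_iff, one_ne_zero, and_false, if_false, if_true, add_zero]
    simp only [pow_zero, Nat.factorial_zero, Nat.cast_one, div_one] at h
    rw [sub_sub, add_comm (1 : ℝ)]
    refine h.trans ?_
    rw [mul_comm]
    refine mul_le_mul_of_nonneg_right ?_ (by positivity)
    rw [div_le_iff₀ (by positivity)]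
    have h3 : (1 : ℝ) ≤ ((N + 1).factorial : ℝ) := by exact_mod_cast Nat.factorial_pos (N + 1)
    have h4 : (0 : ℝ) ≤ N := N.cast_nonneg
    push_cast at *
    nlinarith

/-! ### Termwise expansion under the integral sign -/

/-- The coefficient of `ε ^ m` in `(exp (σ ε L) - 1) g(ε u)`, where `L = log (1 + exp (-u))` and
`g` has Taylor coefficients `b`. -/
noncomputable def coeffDensity (σ : ℝ) (b : ℕ → ℝ) (m : ℕ) (u : ℝ) : ℝ :=
  ∑ j ∈ Finset.range (m + 1), (if j = 0 then 0 else σ ^ j / j.factorial) *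
    Real.log (1 + Real.exp (-u)) ^ j * (b (m - j) * u ^ (m - j))

lemma log_one_add_exp_neg_nonneg (u : ℝ) : 0 ≤ Real.log (1 + Real.exp (-u)) :=
  Real.log_nonneg (by linarith [Real.exp_pos (-u)])

lemma log_one_add_exp_neg_le (u : ℝ) : Real.log (1 + Real.exp (-u)) ≤ Real.exp (-u) := by
  have := Real.log_le_sub_one_of_pos (show 0 < 1 + Real.exp (-u) by positivity)
  linarith

lemma log_one_add_exp_neg_le_one {u : ℝ} (hu : 0 ≤ u) : Real.log (1 + Real.exp (-u)) ≤ 1 :=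
  (log_one_add_exp_neg_le u).trans (Real.exp_le_one_iff.2 (by linarith))

/-- Because the term `j = 0` is absent, every error term carries a factor `L ≤ exp (-u)`, while the
powers of `u` from the Taylor series of `g` are absorbed by `(1 + u) ^ N`. The result is an
integrable bound, uniform in `ε`. -/
lemma abs_sub_sum_coeffDensity_le {σ : ℝ} (hσ : |σ| ≤ 1) {g : ℝ → ℝ} {b C : ℕ → ℝ}
    (hg : ∀ N s, 0 ≤ s → |g s - ∑ k ∈ Finset.range N, b k * s ^ k| ≤ C N * s ^ N)
    (N : ℕ) {ε u : ℝ} (hε : 0 ≤ ε) (hε1 : ε ≤ 1) (hu : 0 ≤ u) :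
    |(Real.exp (σ * ε * Real.log (1 + Real.exp (-u))) - 1) * g (ε * u) -
        ∑ m ∈ Finset.range N, ε ^ m * coeffDensity σ b m u| ≤
      (∑ j ∈ Finset.range N, C (N - j) + 2 * C 0) * ε ^ N * (Real.exp (-u) * (1 + u) ^ N) := by
  set L := Real.log (1 + Real.exp (-u)) with hL
  have hL0 : 0 ≤ L := log_one_add_exp_neg_nonneg u
  have hL1 : L ≤ 1 := log_one_add_exp_neg_le_one hu
  have hLe : L ≤ Real.exp (-u) := log_one_add_exp_neg_le u
  have hC : ∀ n, 0 ≤ C n := fun n => by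
    have := (abs_nonneg _).trans (hg n 1 zero_le_one)
    simpa using this
  have hLpow : ∀ j, j ≠ 0 → L ^ j ≤ L := fun j hj => pow_le_of_le_one hL0 hL1 hj
  have hσpow : ∀ j, |σ| ^ j ≤ 1 := fun j => pow_le_one₀ (abs_nonneg _) hσ
  have hεpow : ∀ j, ε ^ j ≤ 1 := fun j => pow_le_one₀ hε hε1
  have h1u : ∀ k, k ≤ N → u ^ k ≤ (1 + u) ^ N := fun k hk =>
    (pow_le_pow_left₀ hu (by linarith) k).trans (pow_le_pow_right₀ (by linarith) hk)
  have h1N : 1 ≤ (1 + u) ^ N := one_le_pow₀ (by linarith)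
  have hid := mul_sub_sum_cauchy (Real.exp (σ * ε * L) - 1) (g (ε * u))
    (fun j => (if j = 0 then 0 else σ ^ j / j.factorial) * L ^ j) (fun k => b k * u ^ k) ε N
  unfold coeffDensity
  rw [← hL, hid]
  have hx : |σ * ε * L| ≤ 1 := by
    rw [abs_mul, abs_mul, abs_of_nonneg hε, abs_of_nonneg hL0]
    exact mul_le_one₀ (mul_le_one₀ hσ hε hε1) hL0 hL1
  have hA : |Real.exp (σ * ε * L) - 1 - ∑ j ∈ Finset.range N,
      (if j = 0 then 0 else σ ^ j / j.factorial) * L ^ j * ε ^ j| ≤ 2 * (ε ^ N * L) := by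
    have h := abs_exp_sub_one_sub_sum_le hx N
    have e : ∀ j : ℕ, (if j = 0 then 0 else (σ * ε * L) ^ j / j.factorial) =
        (if j = 0 then 0 else σ ^ j / j.factorial) * L ^ j * ε ^ j := by
      intro j
      split_ifs
      · simp
      · rw [mul_pow, mul_pow]; ring
    simp_rw [e] at h
    refine h.trans ?_
    rw [abs_mul, abs_mul, abs_of_nonneg hε, abs_of_nonneg hL0, mul_pow, mul_pow]
    have i1 : ε ^ max N 1 ≤ ε ^ N := pow_le_pow_of_le_one hε hε1 (le_max_left _ _)
    have i2 := hLpow (max N 1) (by simp)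
    have i3 := hσpow (max N 1)
    have : |σ| ^ max N 1 * ε ^ max N 1 ≤ ε ^ N := by
      calc _ ≤ 1 * ε ^ N := mul_le_mul i3 i1 (by positivity) zero_le_one
        _ = _ := one_mul _
    have := mul_le_mul this i2 (by positivity) (by positivity)
    linarith
  have hg0 : |g (ε * u)| ≤ C 0 := by simpa using hg 0 (ε * u) (by positivity)
  have hB : ∀ j ∈ Finset.range N, |(if j = 0 then 0 else σ ^ j / j.factorial) * L ^ j * ε ^ j *
      (g (ε * u) - ∑ k ∈ Finset.range (N - j), b k * u ^ k * ε ^ k)| ≤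
      C (N - j) * (ε ^ N * (Real.exp (-u) * (1 + u) ^ N)) := by
    intro j hj
    have hjN : j ≤ N := (Finset.mem_range.1 hj).le
    split_ifs with h0
    · have := hC (N - j)
      simp only [zero_mul, abs_zero]
      positivity
    · have q := hg (N - j) (ε * u) (by positivity)
      have e : ∀ k, b k * (ε * u) ^ k = b k * u ^ k * ε ^ k := fun k => by rw [mul_pow]; ring
      simp_rw [e] at q
      rw [abs_mul, abs_mul, abs_mul, abs_div, abs_pow, abs_pow, abs_pow, abs_of_nonneg hε,
        abs_of_nonneg hL0]
      have f1 : |σ| ^ j / |(j.factorial : ℝ)| ≤ 1 := by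
        have h3 : (1 : ℝ) ≤ (j.factorial : ℝ) := by exact_mod_cast Nat.factorial_pos j
        rw [abs_of_nonneg (zero_le_one.trans h3)]
        exact div_le_one_of_le₀ ((hσpow j).trans h3) (by positivity)
      calc _ ≤ 1 * Real.exp (-u) * ε ^ j * (C (N - j) * (ε * u) ^ (N - j)) := by
            gcongr
            exact (hLpow j h0).trans hLe
        _ = C (N - j) * (ε ^ N * (Real.exp (-u) * u ^ (N - j))) := by
            rw [mul_pow, ← Nat.add_sub_of_le hjN, pow_add]
            simp only [Nat.add_sub_cancel_left]
            ring
        _ ≤ _ := by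
            have := hC (N - j)
            have := h1u (N - j) (by omega)
            gcongr
  refine (abs_add_le _ _).trans ?_
  rw [add_mul, add_mul]
  refine add_le_add ?_ ?_
  · refine (Finset.abs_sum_le_sum_abs _ _).trans ((Finset.sum_le_sum hB).trans ?_)
    rw [← Finset.sum_mul, mul_assoc]
  · rw [abs_mul]
    calc _ ≤ 2 * (ε ^ N * L) * C 0 := by gcongr
      _ ≤ 2 * (ε ^ N * (Real.exp (-u) * (1 + u) ^ N)) * C 0 := by
          have := hC 0
          gcongr
          exact hLe.trans (le_mul_of_one_le_right (Real.exp_pos _).le h1N)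
      _ = _ := by ring

lemma integrableOn_exp_neg_mul_one_add_pow (N : ℕ) :
    IntegrableOn (fun u : ℝ => Real.exp (-u) * (1 + u) ^ N) (Ioi 0) := by
  have h : ∀ k : ℕ, IntegrableOn (fun u : ℝ => Real.exp (-u) * u ^ k) (Ioi 0) := fun k => by
    have := Real.GammaIntegral_convergent (s := k + 1) (by positivity)
    refine this.congr_fun (fun u _ => ?_) measurableSet_Ioi
    simp
  have e : (fun u : ℝ => Real.exp (-u) * (1 + u) ^ N) =
      fun u => ∑ k ∈ Finset.range (N + 1), N.choose k * (Real.exp (-u) * u ^ k) := by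
    funext u
    rw [add_comm, add_pow, Finset.mul_sum]
    exact Finset.sum_congr rfl fun k _ => by simp; ring
  rw [e]
  exact integrable_finsetSum _ fun k _ => (h k).const_mul _

lemma continuous_log_one_add_exp_neg :
    Continuous fun u : ℝ => Real.log (1 + Real.exp (-u)) :=
  Continuous.log (by fun_prop) fun u => by positivity

lemma integrableOn_coeffDensity (σ : ℝ) (b : ℕ → ℝ) (m : ℕ) :
    IntegrableOn (coeffDensity σ b m) (Ioi 0) := by
  unfold coeffDensity
  refine integrable_finsetSum _ fun j _ => ?_
  rcases eq_or_ne j 0 with rfl | hj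
  · simp
  refine ((integrableOn_exp_neg_mul_one_add_pow (m - j)).const_mul
    (|σ ^ j / j.factorial| * |b (m - j)|)).mono' ?_ ?_
  · exact (((continuous_log_one_add_exp_neg.pow j).const_mul _).mul
      (by fun_prop)).aestronglyMeasurable
  · refine (ae_restrict_iff' measurableSet_Ioi).2 (Eventually.of_forall fun u hu => ?_)
    have hu0 : (0 : ℝ) ≤ u := le_of_lt hu
    have hL0 := log_one_add_exp_neg_nonneg u
    rw [if_neg hj, Real.norm_eq_abs, abs_mul, abs_mul, abs_mul, abs_pow, abs_pow,
      abs_of_nonneg hL0, abs_of_nonneg hu0, mul_mul_mul_comm]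
    gcongr
    · exact (pow_le_of_le_one hL0 (log_one_add_exp_neg_le_one hu0) hj).trans
        (log_one_add_exp_neg_le u)
    · linarith

lemma integrableOn_exp_log_sub_one_mul {σ : ℝ} (hσ : |σ| ≤ 1) {g : ℝ → ℝ} (hgc : Continuous g)
    {b C : ℕ → ℝ} (hg : ∀ N s, 0 ≤ s → |g s - ∑ k ∈ Finset.range N, b k * s ^ k| ≤ C N * s ^ N)
    {ε : ℝ} (hε : 0 ≤ ε) (hε1 : ε ≤ 1) :
    IntegrableOn (fun u => (Real.exp (σ * ε * Real.log (1 + Real.exp (-u))) - 1) * g (ε * u))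
      (Ioi 0) := by
  refine ((integrableOn_exp_neg_mul_one_add_pow 0).const_mul (2 * C 0)).mono' ?_ ?_
  · have := continuous_log_one_add_exp_neg
    exact Continuous.aestronglyMeasurable (by fun_prop)
  · refine (ae_restrict_iff' measurableSet_Ioi).2 (Eventually.of_forall fun u hu => ?_)
    simpa using abs_sub_sum_coeffDensity_le hσ hg 0 hε hε1 (le_of_lt hu)

/-- Asymptotic expansion of `∫ (exp (σ ε log (1 + exp (-u))) - 1) g(ε u) du` as `ε → 0⁺`. -/
lemma exists_abs_integral_sub_sum_le {σ : ℝ} (hσ : |σ| ≤ 1) {g : ℝ → ℝ} (hgc : Continuous g)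
    {b C : ℕ → ℝ} (hg : ∀ N s, 0 ≤ s → |g s - ∑ k ∈ Finset.range N, b k * s ^ k| ≤ C N * s ^ N)
    (N : ℕ) : ∃ D, ∀ ε, 0 ≤ ε → ε ≤ 1 →
      |(∫ u in Ioi (0 : ℝ),
          (Real.exp (σ * ε * Real.log (1 + Real.exp (-u))) - 1) * g (ε * u)) -
        ∑ m ∈ Finset.range N, ε ^ m * ∫ u in Ioi (0 : ℝ), coeffDensity σ b m u| ≤ D * ε ^ N := by
  refine ⟨(∑ j ∈ Finset.range N, C (N - j) + 2 * C 0) *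
    ∫ u in Ioi (0 : ℝ), Real.exp (-u) * (1 + u) ^ N, fun ε hε hε1 => ?_⟩
  have hi := integrableOn_exp_log_sub_one_mul hσ hgc hg hε hε1
  have hs : ∀ m ∈ Finset.range N, Integrable (fun u => ε ^ m * coeffDensity σ b m u)
      (volume.restrict (Ioi 0)) := fun m _ => (integrableOn_coeffDensity σ b m).const_mul _
  rw [mul_right_comm]
  simp_rw [← integral_const_mul]
  rw [← integral_finsetSum _ hs, ← integral_sub hi (integrable_finsetSum _ hs),
    ← Real.norm_eq_abs]
  refine norm_integral_le_of_norm_le ((integrableOn_exp_neg_mul_one_add_pow N).const_mul _) ?_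
  refine (ae_restrict_iff' measurableSet_Ioi).2 (Eventually.of_forall fun u hu => ?_)
  exact abs_sub_sum_coeffDensity_le hσ hg N hε hε1 (le_of_lt hu)

/-- Uniqueness of the coefficients of an asymptotic expansion at `0⁺`. -/
lemma eq_zero_of_abs_sum_le (N : ℕ) : ∀ (a : ℕ → ℝ) (D δ : ℝ), 0 < δ →
    (∀ ε, 0 < ε → ε ≤ δ → |∑ m ∈ Finset.range N, ε ^ m * a m| ≤ D * ε ^ N) →
    ∀ m < N, a m = 0 := by
  induction N with
  | zero => intro a D δ _ _ m hm; omega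
  | succ N ih =>
    intro a D δ hδ h
    -- Letting `ε → 0⁺` kills the constant term; the rest is divided by `ε` and the induction
    -- hypothesis applies.
    have h0 : a 0 = 0 := by
      have t1 : Tendsto (fun ε : ℝ => |∑ m ∈ Finset.range (N + 1), ε ^ m * a m|)
          (nhdsWithin 0 (Ioi 0)) (nhds |a 0|) := by
        have : Continuous fun ε : ℝ => |∑ m ∈ Finset.range (N + 1), ε ^ m * a m| := by fun_prop
        have := this.tendsto 0
        simp only [Finset.sum_range_succ' _ N] at this ⊢
        exact (by simpa using this : Tendsto _ _ (nhds |a 0|)).mono_left nhdsWithin_le_nhds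
      have t2 : Tendsto (fun ε : ℝ => D * ε ^ (N + 1)) (nhdsWithin 0 (Ioi 0)) (nhds 0) := by
        have : Continuous fun ε : ℝ => D * ε ^ (N + 1) := by fun_prop
        have := this.tendsto 0
        exact (by simpa using this : Tendsto _ _ (nhds (0 : ℝ))).mono_left nhdsWithin_le_nhds
      have : |a 0| ≤ 0 := le_of_tendsto_of_tendsto t1 t2 <| by
        filter_upwards [Ioc_mem_nhdsGT hδ] with ε hε using h ε hε.1 hε.2
      exact abs_nonpos_iff.1 this
    have := ih (fun m => a (m + 1)) D δ hδ fun ε hε hεδ => by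
      have q := h ε hε hεδ
      rw [Finset.sum_range_succ', h0] at q
      have e : ∑ k ∈ Finset.range N, ε ^ (k + 1) * a (k + 1) + ε ^ 0 * 0 =
          ε * ∑ m ∈ Finset.range N, ε ^ m * a (m + 1) := by
        rw [Finset.mul_sum, mul_zero, add_zero]
        exact Finset.sum_congr rfl fun k _ => by ring
      rw [e, abs_mul, abs_of_pos hε] at q
      refine le_of_mul_le_mul_left (q.trans_eq ?_) hε
      ring
    intro m hm
    rcases m with _ | m
    · exact h0
    · exact this m (by omega)

/-! ### The two Taylor series and their agreement -/

/-- Polynomials `p k` with `(d/ds)ᵏ (y² (1 - y)) = p k (y)` for `y = sigmoid s`. -/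
noncomputable def sigmoidDerivPoly : ℕ → Polynomial ℝ
  | 0 => Polynomial.X ^ 2 * (1 - Polynomial.X)
  | k + 1 => Polynomial.derivative (sigmoidDerivPoly k) * (Polynomial.X * (1 - Polynomial.X))

/-- Taylor coefficients at `0` of `y² (1 - y)`, where `y = sigmoid s`. -/
noncomputable def sigmoidCoeff (k : ℕ) : ℝ :=
  (sigmoidDerivPoly k).eval 2⁻¹ / k.factorial

/-- All derivatives are polynomials in `y ∈ [0, 1]`, hence bounded by compactness. -/
lemma exists_sigmoid_taylor_bound : ∃ C : ℕ → ℝ, ∀ N s, 0 ≤ s →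
    |Real.sigmoid s ^ 2 * (1 - Real.sigmoid s) -
      ∑ k ∈ Finset.range N, sigmoidCoeff k * s ^ k| ≤ C N * s ^ N := by
  have hb : ∀ N, ∃ C : ℝ, ∀ y ∈ Icc (0 : ℝ) 1, ‖(sigmoidDerivPoly N).eval y‖ ≤ C := fun N =>
    isCompact_Icc.exists_bound_of_continuousOn (sigmoidDerivPoly N).continuous.continuousOn
  choose C hC using hb
  refine ⟨C, fun N s hs => ?_⟩
  have := abs_sub_sum_taylor_le N (fun k s => (sigmoidDerivPoly k).eval (Real.sigmoid s)) (C N)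
    (fun k s => by
      refine (((sigmoidDerivPoly k).hasDerivAt (Real.sigmoid s)).comp s
        (Real.hasDerivAt_sigmoid s)).congr_deriv ?_
      simp [sigmoidDerivPoly])
    (fun s _ => hC N _ ⟨Real.sigmoid_nonneg s, Real.sigmoid_le_one s⟩) s hs
  simpa [sigmoidDerivPoly, sigmoidCoeff, Real.sigmoid_zero] using this

/-- The primitive cube root of unity `exp (2πi/3)`. -/
noncomputable def cubeRoot : ℂ := ⟨-1 / 2, √3 / 2⟩

@[simp] lemma cubeRoot_re : cubeRoot.re = -1 / 2 := rfl
@[simp] lemma cubeRoot_im : cubeRoot.im = √3 / 2 := rfl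

lemma cubeRoot_mul_conj : cubeRoot * (starRingEnd ℂ) cubeRoot = 1 := by
  rw [Complex.mul_conj, Complex.normSq_apply]
  have := Real.mul_self_sqrt (show (0 : ℝ) ≤ 3 by norm_num)
  norm_cast
  simp only [cubeRoot_re, cubeRoot_im]
  linarith

lemma cubeRoot_add_conj : cubeRoot + (starRingEnd ℂ) cubeRoot = -1 := by
  rw [Complex.add_conj]; norm_num

lemma norm_cubeRoot : ‖cubeRoot‖ = 1 := by
  have h := cubeRoot_mul_conj
  rw [Complex.mul_conj, Complex.normSq_eq_norm_sq] at h
  have h : ‖cubeRoot‖ ^ 2 = 1 := by exact_mod_cast h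
  exact (pow_eq_one_iff_of_nonneg (norm_nonneg _) two_ne_zero).1 h

lemma cubeRoot_sq : cubeRoot ^ 2 = -1 - cubeRoot := by
  linear_combination cubeRoot * cubeRoot_add_conj - cubeRoot_mul_conj

lemma cubeRoot_cube : cubeRoot ^ 3 = 1 := by
  linear_combination (cubeRoot - 1) * cubeRoot_sq

/-- Taylor coefficients at `0` of `Re exp (ω s)`, where `ω` is a cube root of unity. -/
noncomputable def cubeRootCoeff (k : ℕ) : ℝ := (cubeRoot ^ k).re / k.factorial

/-- Since `Re ω < 0` and `|ω| = 1`, all derivatives are bounded by `1` on the half line. -/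
lemma exists_cubeRoot_taylor_bound : ∃ C : ℕ → ℝ, ∀ N (s : ℝ), 0 ≤ s →
    |(Complex.exp (cubeRoot * s)).re -
      ∑ k ∈ Finset.range N, cubeRootCoeff k * s ^ k| ≤ C N * s ^ N := by
  refine ⟨fun _ => 1, fun N s hs => ?_⟩
  have := abs_sub_sum_taylor_le N (fun k s => (cubeRoot ^ k * Complex.exp (cubeRoot * s)).re) 1
    (fun k s => by
      have h : HasDerivAt (fun s : ℝ => cubeRoot ^ k * Complex.exp (cubeRoot * s))
          (cubeRoot ^ (k + 1) * Complex.exp (cubeRoot * s)) s := by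
        have h1 : HasDerivAt (fun s : ℝ => cubeRoot * (s : ℂ)) cubeRoot s := by
          simpa using (Complex.ofRealCLM.hasDerivAt (x := s)).const_mul cubeRoot
        exact (h1.cexp.const_mul (cubeRoot ^ k)).congr_deriv (by ring)
      exact Complex.reCLM.hasFDerivAt.comp_hasDerivAt s h)
    (fun s hs => by
      refine (Complex.abs_re_le_norm _).trans ?_
      rw [norm_mul, norm_pow, norm_cubeRoot, one_pow, one_mul, Complex.norm_exp,
        Complex.re_mul_ofReal, cubeRoot_re]
      exact Real.exp_le_one_iff.2 (by linarith)) s hs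
  simpa [cubeRootCoeff] using this

/-- This coincidence of low-order coefficients lets the cube root integral stand in for the original
one. -/
lemma sigmoidCoeff_eq {k : ℕ} (hk : k < 4) :
    sigmoidCoeff k = (-1) ^ k / 8 * cubeRootCoeff k := by
  interval_cases k
  · simp [sigmoidCoeff, cubeRootCoeff, sigmoidDerivPoly]; norm_num
  · simp [sigmoidCoeff, cubeRootCoeff, sigmoidDerivPoly]; norm_num
  · simp [sigmoidCoeff, cubeRootCoeff, sigmoidDerivPoly, cubeRoot_sq]; norm_num
  · simp [sigmoidCoeff, cubeRootCoeff, sigmoidDerivPoly, cubeRoot_cube, Nat.factorial]; norm_num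

lemma coeffDensity_sigmoid_eq {m : ℕ} (hm : m < 5) (u : ℝ) :
    coeffDensity 1 sigmoidCoeff m u = (-1) ^ m / 8 * coeffDensity (-1) cubeRootCoeff m u := by
  unfold coeffDensity
  rw [Finset.mul_sum]
  refine Finset.sum_congr rfl fun j hj => ?_
  have hj : j ≤ m := Nat.lt_succ_iff.1 (Finset.mem_range.1 hj)
  split_ifs with h0
  · simp
  -- Here `j ≥ 1`, so `m - j < 4`: agreement up to order 3 reaches `m = 4`.
  rw [sigmoidCoeff_eq (by omega)]
  rw [show (-1 : ℝ) ^ m = (-1) ^ j * (-1) ^ (m - j) by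
    rw [← pow_add, Nat.add_sub_of_le hj], one_pow]
  have : ((-1 : ℝ) ^ j) * (-1) ^ j = 1 := by rw [← mul_pow]; simp
  linear_combination (-(1 / 8) * (1 / (j.factorial : ℝ)) * Real.log (1 + Real.exp (-u)) ^ j *
    (-1) ^ (m - j) * cubeRootCoeff (m - j) * u ^ (m - j)) * this

/-! ### The two integrals -/

lemma image_sigmoid_Ioi {ε : ℝ} (hε : 0 < ε) :
    (fun u => Real.sigmoid (ε * u)) '' Ioi 0 = Ioo 2⁻¹ 1 := by
  ext x
  constructor
  · rintro ⟨u, hu, rfl⟩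
    refine ⟨?_, Real.sigmoid_lt_one _⟩
    rw [← Real.sigmoid_zero]
    exact Real.sigmoid_strictMono (mul_pos hε hu)
  · rintro ⟨h1, h2⟩
    obtain ⟨s, rfl⟩ : x ∈ range Real.sigmoid := by
      rw [Real.range_sigmoid]; exact ⟨by linarith [show (0 : ℝ) < 2⁻¹ by norm_num], h2⟩
    rw [← Real.sigmoid_zero] at h1
    have hs : 0 < s := Real.sigmoid_strictMono.lt_iff_lt.1 h1
    exact ⟨s / ε, div_pos hs hε, by simp only [mul_div_cancel₀ s hε.ne']⟩

/-- Used with scale `1/n` for the power mean and with scale `1` for the complex Beta integral, hence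
the general codomain. -/
lemma integral_Ioo_eq_integral_sigmoid {E : Type*} [NormedAddCommGroup E] [NormedSpace ℝ E]
    {ε : ℝ} (hε : 0 < ε) (F : ℝ → E) :
    ∫ x in Ioo 2⁻¹ 1, F x = ∫ u in Ioi (0 : ℝ),
      (ε * (Real.sigmoid (ε * u) * (1 - Real.sigmoid (ε * u)))) • F (Real.sigmoid (ε * u)) := by
  have hd : ∀ u : ℝ, HasDerivAt (fun u => Real.sigmoid (ε * u))
      (ε * (Real.sigmoid (ε * u) * (1 - Real.sigmoid (ε * u)))) u := fun u => by
    have h := (hasDerivAt_id u).const_mul ε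
    refine ((Real.hasDerivAt_sigmoid (ε * u)).comp u h).congr_deriv ?_
    simp; ring
  have hinj : InjOn (fun u => Real.sigmoid (ε * u)) (Ioi 0) := fun u _ v _ h =>
    mul_left_cancel₀ hε.ne' (Real.sigmoid_injective h)
  rw [← image_sigmoid_Ioi hε, integral_image_eq_integral_abs_deriv_smul measurableSet_Ioi
    (fun u _ => (hd u).hasDerivWithinAt) hinj]
  refine setIntegral_congr_fun measurableSet_Ioi fun u _ => ?_
  have h1 := Real.sigmoid_pos (ε * u)
  have h2 := Real.sigmoid_lt_one (ε * u)
  rw [abs_of_nonneg]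
  exact mul_nonneg hε.le (mul_nonneg h1.le (by linarith))

/-- Folding at `1/2` confines `u` to the positive half line, where `exp (-u)` decays. -/
lemma integral_zero_one_eq_integral_Ioo {E : Type*} [NormedAddCommGroup E] [NormedSpace ℝ E]
    {f : ℝ → E} (hf : IntervalIntegrable f volume 0 1) :
    ∫ x in (0 : ℝ)..1, f x = ∫ x in Ioo 2⁻¹ 1, (f x + f (1 - x)) := by
  have h1 : IntervalIntegrable f volume 0 2⁻¹ := hf.mono_set (by
    rw [uIcc_of_le, uIcc_of_le] <;> [apply Icc_subset_Icc; skip; skip] <;> norm_num)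
  have h2 : IntervalIntegrable f volume 2⁻¹ 1 := hf.mono_set (by
    rw [uIcc_of_le, uIcc_of_le] <;> [apply Icc_subset_Icc; skip; skip] <;> norm_num)
  have h3 : IntervalIntegrable (fun x => f (1 - x)) volume 2⁻¹ 1 := by
    have := (h1.comp_sub_left 1).symm
    norm_num at this ⊢
    exact this
  rw [← integral_Ioc_eq_integral_Ioo, ← intervalIntegral.integral_of_le (by norm_num),
    intervalIntegral.integral_add h2 h3, intervalIntegral.integral_comp_sub_left,
    ← intervalIntegral.integral_add_adjacent_intervals h1 h2, add_comm]
  norm_num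

lemma one_sub_sigmoid (s : ℝ) : 1 - Real.sigmoid s = Real.sigmoid s * Real.exp (-s) := by
  rw [Real.sigmoid_mul_rexp_neg, Real.sigmoid_neg]

lemma log_sigmoid (s : ℝ) : Real.log (Real.sigmoid s) = -Real.log (1 + Real.exp (-s)) := by
  rw [Real.sigmoid_def, Real.log_inv]

lemma integrableOn_sigmoid_sq_mul {ε : ℝ} (hε : 0 < ε) :
    IntegrableOn (fun u => Real.sigmoid (ε * u) ^ 2 * (1 - Real.sigmoid (ε * u))) (Ioi 0) := by
  refine (integrableOn_exp_mul_Ioi (a := -ε) (by linarith) 0).mono' ?_ ?_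
  · have := _root_.continuous_sigmoid
    exact Continuous.aestronglyMeasurable (by fun_prop)
  · refine Eventually.of_forall fun u => ?_
    have h0 := Real.sigmoid_nonneg (ε * u)
    have h1 := Real.sigmoid_le_one (ε * u)
    rw [one_sub_sigmoid, Real.norm_eq_abs, abs_of_nonneg (by positivity), ← mul_assoc, ← pow_succ,
      neg_mul]
    exact mul_le_of_le_one_left (Real.exp_pos _).le (pow_le_one₀ h0 h1)

lemma integral_sigmoid_sq_mul {ε : ℝ} (hε : 0 < ε) :
    2 * ε * ∫ u in Ioi (0 : ℝ), Real.sigmoid (ε * u) ^ 2 * (1 - Real.sigmoid (ε * u)) = 3 / 4 := by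
  have h := integral_Ioo_eq_integral_sigmoid hε fun x : ℝ => 2 * x
  rw [← integral_Ioc_eq_integral_Ioo, ← intervalIntegral.integral_of_le (by norm_num),
    intervalIntegral.integral_const_mul, integral_id] at h
  rw [← integral_const_mul]
  calc _ = _ := integral_congr_ae (Eventually.of_forall fun u => by simp only [smul_eq_mul]; ring)
    _ = _ := h.symm
    _ = _ := by norm_num

lemma powerMeanIntegral_eq {n : ℝ} (hn : 1 ≤ n) :
    powerMeanIntegral n = 3 / 4 + 2 * n⁻¹ * ∫ u in Ioi (0 : ℝ),
      (Real.exp (1 * n⁻¹ * Real.log (1 + Real.exp (-u))) - 1) *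
        (Real.sigmoid (n⁻¹ * u) ^ 2 * (1 - Real.sigmoid (n⁻¹ * u))) := by
  have hn0 : 0 < n := by linarith
  have hε : 0 < n⁻¹ := inv_pos.2 hn0
  have hε1 : n⁻¹ ≤ 1 := inv_le_one_of_one_le₀ hn
  have hcont : Continuous fun x : ℝ => (x ^ n + (1 - x) ^ n) ^ (1 / n) := by
    refine Continuous.rpow_const (Continuous.add ?_ ?_) fun _ => Or.inr (by positivity)
    · exact Continuous.rpow_const continuous_id fun _ => Or.inr hn0.le
    · exact Continuous.rpow_const (by fun_prop) fun _ => Or.inr hn0.le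
  obtain ⟨C, hC⟩ := exists_sigmoid_taylor_bound
  have hcs := _root_.continuous_sigmoid
  have hi := integrableOn_exp_log_sub_one_mul (σ := 1) (by simp)
    (g := fun s => Real.sigmoid s ^ 2 * (1 - Real.sigmoid s)) (by fun_prop) hC hε.le hε1
  rw [← integral_sigmoid_sq_mul hε, ← mul_add,
    ← integral_add (integrableOn_sigmoid_sq_mul hε) hi, powerMeanIntegral,
    integral_zero_one_eq_integral_Ioo (hcont.intervalIntegrable 0 1),
    integral_Ioo_eq_integral_sigmoid hε, ← integral_const_mul]
  refine integral_congr_ae (Eventually.of_forall fun u => ?_)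
  simp only [smul_eq_mul, sub_sub_cancel]
  set y := Real.sigmoid (n⁻¹ * u) with hy
  have hy0 : 0 < y := Real.sigmoid_pos _
  have h1 : (1 - y) ^ n = y ^ n * Real.exp (-u) := by
    rw [one_sub_sigmoid, Real.mul_rpow hy0.le (Real.exp_pos _).le, ← Real.exp_mul]
    congr 2
    field_simp
  have h2 : (y ^ n + (1 - y) ^ n) ^ (1 / n) =
      y * Real.exp (1 * n⁻¹ * Real.log (1 + Real.exp (-u))) := by
    rw [h1, show y ^ n + y ^ n * Real.exp (-u) = y ^ n * (1 + Real.exp (-u)) by ring,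
      Real.mul_rpow (by positivity) (by positivity), ← Real.rpow_mul hy0.le,
      mul_one_div_cancel hn0.ne', Real.rpow_one,
      Real.rpow_def_of_pos (show 0 < 1 + Real.exp (-u) by positivity)]
    congr 2
    rw [one_div, one_mul, mul_comm]
  rw [add_comm ((1 - y) ^ n), h2]
  ring

lemma conj_ofReal_cpow {x : ℝ} (hx : 0 < x) (s : ℂ) :
    (starRingEnd ℂ) ((x : ℂ) ^ s) = (x : ℂ) ^ ((starRingEnd ℂ) s) := by
  rw [Complex.cpow_conj _ _ (by rw [Complex.arg_ofReal_of_nonneg hx.le]; exact Real.pi_pos.ne),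
    Complex.conj_ofReal]

/-- With `y = sigmoid u`, `log y = -L` and `log (1 - y) = -L - u`. The exponents `p`, `q` satisfy `p
+ q = ε`, so `y ^ p * (1 - y) ^ q = exp (-εL + ω̄εu)`. -/
lemma betaIntegral_cubeRoot {ε : ℝ} (hε : 0 < ε) :
    Complex.betaIntegral (-cubeRoot * ε) (-(starRingEnd ℂ) cubeRoot * ε) =
      ((2 * ∫ u in Ioi (0 : ℝ), Real.exp (-1 * ε * Real.log (1 + Real.exp (-u))) *
        (Complex.exp (cubeRoot * (ε * u : ℝ))).re : ℝ) : ℂ) := by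
  have hp : 0 < (-cubeRoot * ε).re := by
    rw [Complex.re_mul_ofReal]; simp; linarith
  have hq : 0 < (-(starRingEnd ℂ) cubeRoot * ε).re := by
    rw [Complex.re_mul_ofReal]; simp; linarith
  rw [Complex.betaIntegral, integral_zero_one_eq_integral_Ioo
    (Complex.betaIntegral_convergent hp hq), integral_Ioo_eq_integral_sigmoid one_pos,
    ← integral_const_mul, ← integral_complex_ofReal]
  refine setIntegral_congr_fun measurableSet_Ioi fun u _ => ?_
  simp only [one_mul]
  set y := Real.sigmoid u with hy
  have hy0 : 0 < y := Real.sigmoid_pos _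
  have hy1 : 0 < 1 - y := by linarith [Real.sigmoid_lt_one u]
  have hyc : (y : ℂ) ≠ 0 := by exact_mod_cast hy0.ne'
  have hy1c : ((1 - y : ℝ) : ℂ) ≠ 0 := by exact_mod_cast hy1.ne'
  set p : ℂ := -cubeRoot * ε with hpdef
  set q : ℂ := -(starRingEnd ℂ) cubeRoot * ε with hqdef
  have hpq : (starRingEnd ℂ) p = q := by simp [hpdef, hqdef]
  have hqp : (starRingEnd ℂ) q = p := by simp [hpdef, hqdef]
  have key : ((y * (1 - y) : ℝ) : ℂ) * ((y : ℂ) ^ (p - 1) * ((1 - y : ℝ) : ℂ) ^ (q - 1)) =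
      Real.exp (-1 * ε * Real.log (1 + Real.exp (-u))) *
        Complex.exp ((starRingEnd ℂ) cubeRoot * (ε * u : ℝ)) := by
    have e1 : ((y * (1 - y) : ℝ) : ℂ) * ((y : ℂ) ^ (p - 1) * ((1 - y : ℝ) : ℂ) ^ (q - 1)) =
        (y : ℂ) ^ p * ((1 - y : ℝ) : ℂ) ^ q := by
      rw [Complex.cpow_sub _ _ hyc, Complex.cpow_sub _ _ hy1c, Complex.cpow_one, Complex.cpow_one]
      push_cast at hy1c ⊢
      field_simp
    have l1 : Real.log y = -Real.log (1 + Real.exp (-u)) := log_sigmoid u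
    have l2 : Real.log (1 - y) = -Real.log (1 + Real.exp (-u)) - u := by
      rw [one_sub_sigmoid, Real.log_mul hy0.ne' (Real.exp_pos _).ne', l1, Real.log_exp]; ring
    rw [e1, Complex.cpow_def_of_ne_zero hyc, Complex.cpow_def_of_ne_zero hy1c,
      ← Complex.ofReal_log hy0.le, ← Complex.ofReal_log hy1.le, l1, l2, Complex.ofReal_exp,
      ← Complex.exp_add, ← Complex.exp_add]
    congr 1
    push_cast
    rw [hpdef, hqdef]
    linear_combination (Complex.ofReal (Real.log (1 + Real.exp (-u))) * ε) * cubeRoot_add_conj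
  -- As `p` and `q` are conjugate, the reflection `x ↦ 1 - x` conjugates the integrand, and folding
  -- produces twice a real part.
  have hsum : (y : ℂ) ^ (p - 1) * (1 - (y : ℂ)) ^ (q - 1) +
      ((1 - y : ℝ) : ℂ) ^ (p - 1) * (1 - ((1 - y : ℝ) : ℂ)) ^ (q - 1) =
      (y : ℂ) ^ (p - 1) * ((1 - y : ℝ) : ℂ) ^ (q - 1) +
      (starRingEnd ℂ) ((y : ℂ) ^ (p - 1) * ((1 - y : ℝ) : ℂ) ^ (q - 1)) := by
    rw [map_mul, conj_ofReal_cpow hy0, conj_ofReal_cpow hy1, map_sub, map_sub, hpq, hqp, map_one]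
    push_cast
    rw [sub_sub_cancel]
    ring
  have hc : ∀ (r : ℝ) (z : ℂ), r * (starRingEnd ℂ) z = (starRingEnd ℂ) (r * z) := fun r z => by
    rw [map_mul, Complex.conj_ofReal]
  rw [hsum, Complex.real_smul, mul_add, hc, key, Complex.add_conj, Complex.re_ofReal_mul]
  congr 3
  have : (starRingEnd ℂ) cubeRoot * (ε * u : ℝ) = (starRingEnd ℂ) (cubeRoot * (ε * u : ℝ)) := by
    rw [map_mul, Complex.conj_ofReal]
  rw [this, Complex.exp_conj, Complex.conj_re]

/-! ### The Beta integral as an infinite product -/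

lemma neg_cubeRoot_ne {ε : ℝ} (hε : 0 < ε) (j : ℕ) :
    -cubeRoot * ε + j ≠ 0 ∧ -(starRingEnd ℂ) cubeRoot * ε + j ≠ 0 := by
  have hj : (0 : ℝ) ≤ j := j.cast_nonneg
  constructor
  · intro h
    have := congrArg Complex.re h
    rw [Complex.add_re, Complex.re_mul_ofReal] at this
    simp at this; nlinarith
  · intro h
    have := congrArg Complex.re h
    rw [Complex.add_re, Complex.re_mul_ofReal] at this
    simp at this; nlinarith

/-- The powers of `n` cancel because `-ω - ω̄ = 1`. The factor at `0` gives `ε / ε² = ε⁻¹`, and the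
later ones use `(j - ωε)(j - ω̄ε) = j² + jε + ε²`. -/
lemma GammaSeq_mul_div_eq {ε : ℝ} (hε : 0 < ε) {n : ℕ} (hn : n ≠ 0) :
    Complex.GammaSeq (-cubeRoot * ε) n * Complex.GammaSeq (-(starRingEnd ℂ) cubeRoot * ε) n /
      Complex.GammaSeq ε n =
    ((ε⁻¹ * ∏ j ∈ Finset.range n, (1 + ε / (j + 1 : ℕ)) /
      (1 + ε / (j + 1 : ℕ) + (ε / (j + 1 : ℕ)) ^ 2) : ℝ) : ℂ) := by
  have hn0 : (n : ℂ) ≠ 0 := by exact_mod_cast hn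
  have hεc : (ε : ℂ) ≠ 0 := by exact_mod_cast hε.ne'
  have hf : (n.factorial : ℂ) ≠ 0 := by exact_mod_cast n.factorial_ne_zero
  unfold Complex.GammaSeq
  have hpow : (n : ℂ) ^ (-cubeRoot * ε) * (n : ℂ) ^ (-(starRingEnd ℂ) cubeRoot * ε) =
      (n : ℂ) ^ (ε : ℂ) := by
    rw [← Complex.cpow_add _ _ hn0]
    congr 1
    linear_combination (-(ε : ℂ)) * cubeRoot_add_conj
  have hne : (n : ℂ) ^ (ε : ℂ) ≠ 0 := by
    rw [Complex.cpow_def_of_ne_zero hn0]; exact Complex.exp_ne_zero _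
  have hP : ∏ j ∈ Finset.range (n + 1), (-cubeRoot * ε + j) ≠ 0 :=
    Finset.prod_ne_zero_iff.2 fun j _ => (neg_cubeRoot_ne hε j).1
  have hQ : ∏ j ∈ Finset.range (n + 1), (-(starRingEnd ℂ) cubeRoot * ε + j) ≠ 0 :=
    Finset.prod_ne_zero_iff.2 fun j _ => (neg_cubeRoot_ne hε j).2
  have hprod : (n.factorial : ℂ) * ∏ j ∈ Finset.range (n + 1), ((ε : ℂ) + j) =
      ((ε⁻¹ * ∏ j ∈ Finset.range n, (1 + ε / (j + 1 : ℕ)) /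
      (1 + ε / (j + 1 : ℕ) + (ε / (j + 1 : ℕ)) ^ 2) : ℝ) : ℂ) *
      ((∏ j ∈ Finset.range (n + 1), (-cubeRoot * ε + j)) *
        ∏ j ∈ Finset.range (n + 1), (-(starRingEnd ℂ) cubeRoot * ε + j)) := by
    rw [← Finset.prod_mul_distrib, Finset.prod_range_succ', Finset.prod_range_succ' _ n,
      ← Finset.prod_range_add_one_eq_factorial]
    push_cast
    have e0 : (-cubeRoot * ε + 0) * (-(starRingEnd ℂ) cubeRoot * ε + 0) = (ε : ℂ) ^ 2 := by
      linear_combination (ε : ℂ) ^ 2 * cubeRoot_mul_conj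
    rw [e0]
    have e1 : ∀ j ∈ Finset.range n, ((j : ℂ) + 1) * (ε + (j + 1)) =
        (1 + ε / (j + 1)) / (1 + ε / (j + 1) + (ε / (j + 1)) ^ 2) *
        ((-cubeRoot * ε + (j + 1)) * (-(starRingEnd ℂ) cubeRoot * ε + (j + 1))) := by
      intro j _
      have hj : (j : ℂ) + 1 ≠ 0 := by exact_mod_cast Nat.succ_ne_zero j
      have e2 : (-cubeRoot * ε + (j + 1)) * (-(starRingEnd ℂ) cubeRoot * ε + (j + 1)) =
          ((j : ℂ) + 1) ^ 2 * (1 + ε / (j + 1) + (ε / (j + 1)) ^ 2) := by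
        field_simp
        linear_combination (ε : ℂ) ^ 2 * cubeRoot_mul_conj - (ε : ℂ) * (j + 1) * cubeRoot_add_conj
      have h3 : (1 + (ε : ℂ) / (j + 1) + (ε / (j + 1)) ^ 2) ≠ 0 := by
        have : (1 + ε / (j + 1) + (ε / (j + 1)) ^ 2) ≠ 0 := by positivity
        exact_mod_cast this
      have e3 : ((j : ℂ) + 1) * (ε + (j + 1)) = (1 + ε / (j + 1)) * (j + 1) ^ 2 := by
        field_simp
        ring
      rw [e2, div_mul_eq_mul_div, eq_div_iff h3, e3]
      ring
    rw [add_zero, ← mul_assoc, ← Finset.prod_mul_distrib, Finset.prod_congr rfl e1,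
      Finset.prod_mul_distrib]
    field_simp
  rw [mul_comm] at hprod
  have hR : ∏ j ∈ Finset.range (n + 1), ((ε : ℂ) + j) ≠ 0 :=
    Finset.prod_ne_zero_iff.2 fun j _ => by
      have : ε + j ≠ 0 := by positivity
      exact_mod_cast this
  rw [div_mul_div_comm, div_div_div_eq, div_eq_iff (by positivity)]
  rw [← hpow]
  linear_combination ((n : ℂ) ^ (-cubeRoot * ε) * (n : ℂ) ^ (-(starRingEnd ℂ) cubeRoot * ε) *
    n.factorial) * hprod

lemma tendsto_prod_cubeRoot {ε : ℝ} (hε : 0 < ε) :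
    Tendsto (fun n : ℕ => ∏ j ∈ Finset.range n, (1 + ε / (j + 1 : ℕ)) /
      (1 + ε / (j + 1 : ℕ) + (ε / (j + 1 : ℕ)) ^ 2)) atTop
      (nhds (2 * ε * ∫ u in Ioi (0 : ℝ), Real.exp (-1 * ε * Real.log (1 + Real.exp (-u))) *
        (Complex.exp (cubeRoot * (ε * u : ℝ))).re)) := by
  have hp : 0 < (-cubeRoot * ε).re := by
    rw [Complex.re_mul_ofReal]; simp; linarith
  have hq : 0 < (-(starRingEnd ℂ) cubeRoot * ε).re := by
    rw [Complex.re_mul_ofReal]; simp; linarith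
  have hG : Complex.Gamma ε ≠ 0 :=
    Complex.Gamma_ne_zero_of_re_pos (by simpa using hε)
  have hB := Complex.Gamma_mul_Gamma_eq_betaIntegral hp hq
  rw [show -cubeRoot * (ε : ℂ) + -(starRingEnd ℂ) cubeRoot * ε = ε by
    linear_combination (-(ε : ℂ)) * cubeRoot_add_conj, betaIntegral_cubeRoot hε] at hB
  have ht := ((Complex.GammaSeq_tendsto_Gamma (-cubeRoot * ε)).mul
    (Complex.GammaSeq_tendsto_Gamma (-(starRingEnd ℂ) cubeRoot * ε))).div
    (Complex.GammaSeq_tendsto_Gamma ε) hG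
  rw [hB, mul_div_cancel_left₀ _ hG] at ht
  have ht2 := ht.congr' (f₂ := fun n : ℕ => ((ε⁻¹ * ∏ j ∈ Finset.range n, (1 + ε / (j + 1 : ℕ)) /
      (1 + ε / (j + 1 : ℕ) + (ε / (j + 1 : ℕ)) ^ 2) : ℝ) : ℂ)) <| by
    filter_upwards [eventually_ne_atTop 0] with n hn using GammaSeq_mul_div_eq hε hn
  have ht3 := (Complex.continuous_re.tendsto _).comp ht2
  simp only [Function.comp_def, Complex.ofReal_re] at ht3
  have ht4 := ht3.const_mul ε
  simp only [mul_inv_cancel_left₀ hε.ne'] at ht4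
  convert ht4 using 2
  ring

lemma integral_exp_cubeRoot {ε : ℝ} (hε : 0 < ε) :
    IntegrableOn (fun u : ℝ => (Complex.exp (cubeRoot * (ε * u : ℝ))).re) (Ioi 0) ∧
    2 * ε * ∫ u in Ioi (0 : ℝ), (Complex.exp (cubeRoot * (ε * u : ℝ))).re = 1 := by
  have ha : (cubeRoot * ε).re < 0 := by
    rw [Complex.re_mul_ofReal]; simp; linarith
  have hi := integrableOn_exp_mul_complex_Ioi ha 0
  have h := integral_exp_mul_complex_Ioi ha 0
  have e : ∀ u : ℝ, cubeRoot * (ε * u : ℝ) = cubeRoot * ε * u := fun u => by push_cast; ring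
  simp_rw [e]
  refine ⟨hi.re, ?_⟩
  have h2 := integral_re hi
  simp only [RCLike.re_to_complex] at h2
  rw [h2, h]
  have hεc : (ε : ℂ) ≠ 0 := by exact_mod_cast hε.ne'
  have hw : cubeRoot ≠ 0 := fun h0 => by simpa [h0] using cubeRoot_mul_conj
  have : -Complex.exp (cubeRoot * ε * (0 : ℝ)) / (cubeRoot * ε) =
      -(starRingEnd ℂ) cubeRoot * (ε⁻¹ : ℝ) := by
    simp only [Complex.ofReal_zero, mul_zero, Complex.exp_zero]
    push_cast
    field_simp
    linear_combination cubeRoot_mul_conj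
  rw [this, Complex.re_mul_ofReal]
  simp
  field_simp

lemma tendsto_prod_cubeRoot' {ε : ℝ} (hε : 0 < ε) (hε1 : ε ≤ 1) :
    Tendsto (fun n : ℕ => ∏ j ∈ Finset.range n, (1 + ε / (j + 1 : ℕ)) /
      (1 + ε / (j + 1 : ℕ) + (ε / (j + 1 : ℕ)) ^ 2)) atTop
      (nhds (1 + 2 * ε * ∫ u in Ioi (0 : ℝ),
        (Real.exp (-1 * ε * Real.log (1 + Real.exp (-u))) - 1) *
        (Complex.exp (cubeRoot * (ε * u : ℝ))).re)) := by
  obtain ⟨C, hC⟩ := exists_cubeRoot_taylor_bound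
  have hi := integrableOn_exp_log_sub_one_mul (σ := -1) (by simp)
    (g := fun s : ℝ => (Complex.exp (cubeRoot * s)).re) (by fun_prop) hC hε.le hε1
  have h := integral_exp_cubeRoot hε
  have hsum : ∫ u in Ioi (0 : ℝ), Real.exp (-1 * ε * Real.log (1 + Real.exp (-u))) *
        (Complex.exp (cubeRoot * (ε * u : ℝ))).re =
      (∫ u in Ioi (0 : ℝ), (Complex.exp (cubeRoot * (ε * u : ℝ))).re) + ∫ u in Ioi (0 : ℝ),
        (Real.exp (-1 * ε * Real.log (1 + Real.exp (-u))) - 1) *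
        (Complex.exp (cubeRoot * (ε * u : ℝ))).re := by
    rw [← integral_add h.1 hi]
    refine integral_congr_ae (Eventually.of_forall fun u => ?_)
    ring
  have ht := tendsto_prod_cubeRoot hε
  rwa [hsum, mul_add, h.2] at ht

/-! ### Expansion of the product up to `O(ε⁶)` -/

lemma abs_log_div_add_le {x : ℝ} (hx0 : 0 ≤ x) (hx : x ≤ 1 / 2) :
    |Real.log ((1 + x) / (1 + x + x ^ 2)) - (-x ^ 2 + x ^ 3 - x ^ 4 / 2)| ≤ 4 * x ^ 6 := by
  have hx2 : x ^ 2 ≤ 1 / 4 := by nlinarith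
  have hx3 : x ^ 3 ≤ 1 / 8 := by nlinarith [pow_nonneg hx0 2]
  have h20 : 0 ≤ x ^ 2 := by positivity
  have h30 : 0 ≤ x ^ 3 := by positivity
  have h60 : 0 ≤ x ^ 6 := by positivity
  -- Multiplying through by `1 - x` leaves two logarithms of the form `log (1 - x ^ k)`; no `x ^ 5`
  -- term arises.
  have e : (1 + x) / (1 + x + x ^ 2) = (1 - x ^ 2) / (1 - x ^ 3) := by
    rw [div_eq_div_iff (by positivity) (by linarith)]; ring
  rw [e, Real.log_div (by linarith) (by linarith)]
  have a := Real.abs_log_sub_add_sum_range_le (x := x ^ 2)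
    (by rw [abs_of_nonneg h20]; linarith) 2
  have b := Real.abs_log_sub_add_sum_range_le (x := x ^ 3)
    (by rw [abs_of_nonneg h30]; linarith) 1
  rw [abs_of_nonneg h20] at a
  rw [abs_of_nonneg h30] at b
  have a' : (x ^ 2) ^ (2 + 1) / (1 - x ^ 2) ≤ 2 * x ^ 6 := by
    rw [div_le_iff₀ (by linarith), show (x ^ 2) ^ (2 + 1) = x ^ 6 by ring]
    linarith [mul_nonneg h60 (sub_nonneg.2 hx2)]
  have b' : (x ^ 3) ^ (1 + 1) / (1 - x ^ 3) ≤ 2 * x ^ 6 := by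
    rw [div_le_iff₀ (by linarith), show (x ^ 3) ^ (1 + 1) = x ^ 6 by ring]
    linarith [mul_nonneg h60 (sub_nonneg.2 hx3)]
  have a := a.trans a'
  have b := b.trans b'
  simp only [Finset.sum_range_succ, Finset.sum_range_zero] at a b
  norm_num at a b
  rw [abs_le] at a b ⊢
  constructor <;> nlinarith

/-- The cubic remainder of `exp A` costs `M ^ 3 * ε ^ 6`; replacing `A` by `E` in the quadratic
polynomial costs `2 * M * ε ^ 6`. -/
lemma abs_exp_sub_le_of_near {A E : ℝ} {M ε : ℝ} (hA : |A| ≤ M * ε ^ 2) (hA1 : |A| ≤ 1)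
    (hE1 : |E| ≤ 1) (hAE : |A - E| ≤ M * ε ^ 6) :
    |Real.exp A - (1 + E + E ^ 2 / 2)| ≤ (M ^ 3 + 2 * M) * ε ^ 6 := by
  have h := Real.exp_bound hA1 (n := 3) (by norm_num)
  simp only [Finset.sum_range_succ, Finset.sum_range_zero, Nat.factorial] at h
  norm_num at h
  have h3 : |A| ^ 3 ≤ (M * ε ^ 2) ^ 3 := pow_le_pow_left₀ (abs_nonneg _) hA 3
  have h4 : |(A - E) * (1 + (A + E) / 2)| ≤ M * ε ^ 6 * 2 := by
    rw [abs_mul]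
    refine mul_le_mul hAE ?_ (abs_nonneg _) ((abs_nonneg _).trans hAE)
    rw [abs_le] at hA1 hE1 ⊢
    constructor <;> linarith
  have e : Real.exp A - (1 + E + E ^ 2 / 2) =
      (Real.exp A - (1 + A + A ^ 2 / 2)) + (A - E) * (1 + (A + E) / 2) := by ring
  have h5 : 0 ≤ |A| ^ 3 := by positivity
  rw [e]
  refine (abs_add_le _ _).trans ?_
  nlinarith

lemma hasSum_shift_of_hasSum {k : ℕ} (hk : k ≠ 0) {z : ℝ}
    (h : HasSum (fun n : ℕ => 1 / (n : ℝ) ^ k) z) :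
    Tendsto (fun n : ℕ => ∑ j ∈ Finset.range n, 1 / ((j + 1 : ℕ) : ℝ) ^ k) atTop (nhds z) := by
  have := (hasSum_nat_add_iff' 1).2 h
  simp only [Finset.sum_range_one, Nat.cast_zero, zero_pow hk, div_zero, sub_zero] at this
  exact this.tendsto_sum_nat

/-- Expansion up to `O(ε⁶)` of a limit of `∏ (1 + x) / (1 + x + x²)` over `x = ε / j`. -/
lemma exists_abs_prod_limit_sub_le {z₂ z₃ z₄ : ℝ}
    (h₂ : HasSum (fun n : ℕ => 1 / (n : ℝ) ^ 2) z₂)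
    (h₃ : HasSum (fun n : ℕ => 1 / (n : ℝ) ^ 3) z₃)
    (h₄ : HasSum (fun n : ℕ => 1 / (n : ℝ) ^ 4) z₄) :
    ∃ D δ, 0 < δ ∧ δ ≤ 1 ∧ ∀ ε P : ℝ, 0 < ε → ε ≤ δ →
      Tendsto (fun n : ℕ => ∏ j ∈ Finset.range n, (1 + ε / (j + 1 : ℕ)) /
        (1 + ε / (j + 1 : ℕ) + (ε / (j + 1 : ℕ)) ^ 2)) atTop (nhds P) →
      |P - (1 - z₂ * ε ^ 2 + z₃ * ε ^ 3 + (z₂ ^ 2 / 2 - z₄ / 2) * ε ^ 4 - z₂ * z₃ * ε ^ 5)| ≤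
        D * ε ^ 6 := by
  have hs₆ : Summable (fun n : ℕ => 1 / (n : ℝ) ^ 6) :=
    Real.summable_one_div_nat_pow.2 (by norm_num)
  obtain ⟨z₆, h₆⟩ := hs₆
  have p₂ : 0 ≤ z₂ := h₂.nonneg fun n => by positivity
  have p₃ : 0 ≤ z₃ := h₃.nonneg fun n => by positivity
  have p₄ : 0 ≤ z₄ := h₄.nonneg fun n => by positivity
  have p₆ : 0 ≤ z₆ := h₆.nonneg fun n => by positivity
  set M := z₂ + z₃ + z₄ + 4 * z₆ + 1 with hM
  have hM1 : 1 ≤ M := by linarith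
  -- `R` sums the absolute values of the coefficients of `ε⁶`, `ε⁷`, `ε⁸` in `E ^ 2 / 2`.
  set R := z₃ ^ 2 / 2 + z₂ * z₄ / 2 + z₃ * z₄ / 2 + z₄ ^ 2 / 8 with hR
  refine ⟨M ^ 3 + 2 * M + R, 1 / (2 * M), by positivity, ?_, ?_⟩
  · rw [div_le_one (by positivity)]; linarith
  intro ε P hε hεδ hP
  have hεM : ε * M ≤ 1 / 2 := by
    rw [le_div_iff₀ (by positivity)] at hεδ; linarith
  have hε2 : ε ≤ 1 / 2 := by nlinarith
  set E := -(ε ^ 2 * z₂) + ε ^ 3 * z₃ - ε ^ 4 * z₄ / 2 with hE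
  have q : ∀ k, 2 ≤ k → ε ^ k ≤ ε ^ 2 := fun k hk =>
    pow_le_pow_of_le_one hε.le (by linarith) hk
  have q3 := q 3 (by norm_num)
  have q4 := q 4 (by norm_num)
  have q6 := q 6 (by norm_num)
  have r2 : 0 ≤ ε ^ 2 := by positivity
  have r3 : 0 ≤ ε ^ 3 := by positivity
  have r4 : 0 ≤ ε ^ 4 := by positivity
  have r6 : 0 ≤ ε ^ 6 := by positivity
  have hMε : M * ε ^ 2 ≤ 1 := by
    have := mul_le_mul_of_nonneg_right hεM hε.le
    rw [show M * ε ^ 2 = ε * M * ε by ring]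
    linarith
  -- The values `t = -1` and `t = 1` give the lower and upper bounds that enclose `P`.
  have key : ∀ t : ℝ, |t| ≤ 1 → |Real.exp (E + t * (4 * (ε ^ 6 * z₆))) - (1 + E + E ^ 2 / 2)| ≤
      (M ^ 3 + 2 * M) * ε ^ 6 := by
    intro t ht
    have ht6 : |t * (4 * (ε ^ 6 * z₆))| ≤ 4 * (ε ^ 6 * z₆) := by
      rw [abs_mul, abs_of_nonneg (show 0 ≤ 4 * (ε ^ 6 * z₆) by positivity)]
      exact mul_le_of_le_one_left (by positivity) ht
    have s2 := mul_nonneg r2 p₂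
    have s3 := mul_nonneg r3 p₃
    have s4 := mul_nonneg r4 p₄
    have s6 := mul_nonneg r6 p₆
    have u3 := mul_le_mul_of_nonneg_right q3 p₃
    have u4 := mul_le_mul_of_nonneg_right q4 p₄
    have u6 := mul_le_mul_of_nonneg_right q6 p₆
    have hME : M * ε ^ 2 = ε ^ 2 * z₂ + ε ^ 2 * z₃ + ε ^ 2 * z₄ + 4 * (ε ^ 2 * z₆) + ε ^ 2 := by
      rw [hM]; ring
    rw [abs_le] at ht6
    have hA : |E + t * (4 * (ε ^ 6 * z₆))| ≤ M * ε ^ 2 := by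
      rw [hME, hE, abs_le]; constructor <;> linarith
    have hE1 : |E| ≤ 1 := by
      refine le_trans ?_ hMε
      have := mul_nonneg r2 p₆
      rw [hME, hE, abs_le]; constructor <;> linarith
    refine abs_exp_sub_le_of_near hA (hA.trans hMε) hE1 ?_
    rw [add_sub_cancel_left, abs_le]
    have : 4 * (ε ^ 6 * z₆) ≤ M * ε ^ 6 := by
      have e : M * ε ^ 6 = ε ^ 6 * z₂ + ε ^ 6 * z₃ + ε ^ 6 * z₄ + 4 * (ε ^ 6 * z₆) + ε ^ 6 := by
        rw [hM]; ring
      linarith [mul_nonneg r6 p₂, mul_nonneg r6 p₃, mul_nonneg r6 p₄]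
    constructor <;> linarith
  have t₂ := hasSum_shift_of_hasSum (by norm_num) h₂
  have t₃ := hasSum_shift_of_hasSum (by norm_num) h₃
  have t₄ := hasSum_shift_of_hasSum (by norm_num) h₄
  have t₆ := hasSum_shift_of_hasSum (by norm_num) h₆
  have tE := (((t₂.const_mul (ε ^ 2)).neg.add (t₃.const_mul (ε ^ 3))).sub
    ((t₄.const_mul (ε ^ 4)).div_const 2))
  have hlog : ∀ n : ℕ, |Real.log (∏ j ∈ Finset.range n, (1 + ε / (j + 1 : ℕ)) /
        (1 + ε / (j + 1 : ℕ) + (ε / (j + 1 : ℕ)) ^ 2)) -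
      (-(ε ^ 2 * ∑ j ∈ Finset.range n, 1 / ((j + 1 : ℕ) : ℝ) ^ 2) +
        ε ^ 3 * ∑ j ∈ Finset.range n, 1 / ((j + 1 : ℕ) : ℝ) ^ 3 -
        ε ^ 4 * (∑ j ∈ Finset.range n, 1 / ((j + 1 : ℕ) : ℝ) ^ 4) / 2)| ≤
      4 * (ε ^ 6 * ∑ j ∈ Finset.range n, 1 / ((j + 1 : ℕ) : ℝ) ^ 6) := by
    intro n
    rw [Real.log_prod fun j _ => by positivity]
    simp only [Finset.mul_sum, Finset.sum_div]
    rw [← Finset.sum_neg_distrib, ← Finset.sum_add_distrib, ← Finset.sum_sub_distrib,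
      ← Finset.sum_sub_distrib]
    refine (Finset.abs_sum_le_sum_abs _ _).trans (Finset.sum_le_sum fun j _ => ?_)
    have hj : (1 : ℝ) ≤ ((j + 1 : ℕ) : ℝ) := by exact_mod_cast Nat.succ_pos j
    have := abs_log_div_add_le (x := ε / (j + 1 : ℕ)) (by positivity)
      ((div_le_self hε.le hj).trans hε2)
    refine le_of_eq_of_le (congrArg abs ?_) (this.trans_eq ?_)
    · simp only [div_pow, one_div]
      ring
    · simp only [div_pow, one_div]
      ring
  have hpos : ∀ n : ℕ, 0 < ∏ j ∈ Finset.range n, (1 + ε / (j + 1 : ℕ)) /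
        (1 + ε / (j + 1 : ℕ) + (ε / (j + 1 : ℕ)) ^ 2) :=
    fun n => Finset.prod_pos fun j _ => by positivity
  have hlow : Real.exp (E + (-1) * (4 * (ε ^ 6 * z₆))) ≤ P := by
    refine le_of_tendsto_of_tendsto' ((Real.continuous_exp.tendsto _).comp
      (tE.add (((t₆.const_mul (ε ^ 6)).const_mul 4).const_mul (-1)))) hP fun n => ?_
    have := (abs_le.1 (hlog n)).1
    rw [Function.comp_apply, ← Real.le_log_iff_exp_le (hpos n)]
    linarith
  have hup : P ≤ Real.exp (E + 1 * (4 * (ε ^ 6 * z₆))) := by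
    refine le_of_tendsto_of_tendsto' hP ((Real.continuous_exp.tendsto _).comp
      (tE.add (((t₆.const_mul (ε ^ 6)).const_mul 4).const_mul 1))) fun n => ?_
    have := (abs_le.1 (hlog n)).2
    rw [Function.comp_apply, ← Real.log_le_iff_le_exp (hpos n)]
    linarith
  have k1 := (abs_le.1 (key (-1) (by simp))).1
  have k2 := (abs_le.1 (key 1 (by simp))).2
  have hPE : |P - (1 + E + E ^ 2 / 2)| ≤ (M ^ 3 + 2 * M) * ε ^ 6 := by
    rw [abs_le]; constructor <;> linarith
  have hrem : |(1 + E + E ^ 2 / 2) - (1 - z₂ * ε ^ 2 + z₃ * ε ^ 3 +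
      (z₂ ^ 2 / 2 - z₄ / 2) * ε ^ 4 - z₂ * z₃ * ε ^ 5)| ≤ R * ε ^ 6 := by
    have e : (1 + E + E ^ 2 / 2) - (1 - z₂ * ε ^ 2 + z₃ * ε ^ 3 +
      (z₂ ^ 2 / 2 - z₄ / 2) * ε ^ 4 - z₂ * z₃ * ε ^ 5) =
      (z₃ ^ 2 / 2 + z₂ * z₄ / 2 - z₃ * z₄ / 2 * ε + z₄ ^ 2 / 8 * ε ^ 2) * ε ^ 6 := by
      rw [hE]; ring
    rw [e, abs_mul, abs_of_nonneg r6]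
    refine mul_le_mul_of_nonneg_right ?_ r6
    have a1 : 0 ≤ z₃ * z₄ / 2 := by positivity
    have a2 : 0 ≤ z₄ ^ 2 / 8 := by positivity
    have a3 : 0 ≤ z₃ ^ 2 / 2 := by positivity
    have a4 : 0 ≤ z₂ * z₄ / 2 := by positivity
    have b1 : z₃ * z₄ / 2 * ε ≤ z₃ * z₄ / 2 := mul_le_of_le_one_right a1 (by linarith)
    have b2 : z₄ ^ 2 / 8 * ε ^ 2 ≤ z₄ ^ 2 / 8 := mul_le_of_le_one_right a2 (pow_le_one₀ hε.le (by linarith))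
    have c1 : 0 ≤ z₃ * z₄ / 2 * ε := by positivity
    have c2 : 0 ≤ z₄ ^ 2 / 8 * ε ^ 2 := by positivity
    rw [hR, abs_le]; constructor <;> linarith
  refine (abs_sub_le P (1 + E + E ^ 2 / 2) _).trans ?_
  rw [add_mul _ R]
  exact add_le_add hPE hrem

/-! ### Comparison of coefficients and conclusion -/

/-- The first coefficients in the expansion of the cube root integral, by comparison with the product
formula. -/
lemma integral_coeffDensity_cubeRoot {z₂ z₃ z₄ : ℝ}
    (h₂ : HasSum (fun n : ℕ => 1 / (n : ℝ) ^ 2) z₂)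
    (h₃ : HasSum (fun n : ℕ => 1 / (n : ℝ) ^ 3) z₃)
    (h₄ : HasSum (fun n : ℕ => 1 / (n : ℝ) ^ 4) z₄) :
    (∫ u in Ioi (0 : ℝ), coeffDensity (-1) cubeRootCoeff 0 u) = 0 ∧
    (∫ u in Ioi (0 : ℝ), coeffDensity (-1) cubeRootCoeff 1 u) = -z₂ / 2 ∧
    (∫ u in Ioi (0 : ℝ), coeffDensity (-1) cubeRootCoeff 2 u) = z₃ / 2 ∧
    (∫ u in Ioi (0 : ℝ), coeffDensity (-1) cubeRootCoeff 3 u) = (z₂ ^ 2 - z₄) / 4 ∧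
    (∫ u in Ioi (0 : ℝ), coeffDensity (-1) cubeRootCoeff 4 u) = -(z₂ * z₃) / 2 := by
  obtain ⟨C, hC⟩ := exists_cubeRoot_taylor_bound
  obtain ⟨D₁, hD₁⟩ := exists_abs_integral_sub_sum_le (σ := -1) (by simp)
    (g := fun s : ℝ => (Complex.exp (cubeRoot * s)).re) (by fun_prop) hC 5
  obtain ⟨D₂, δ, hδ, hδ1, hD₂⟩ := exists_abs_prod_limit_sub_le h₂ h₃ h₄
  set I : ℕ → ℝ := fun m => ∫ u in Ioi (0 : ℝ), coeffDensity (-1) cubeRootCoeff m u with hI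
  -- These are the coefficients of `(P - 1) / (2ε)`, where `P` is the infinite product.
  let t : ℕ → ℝ := fun m => match m with
    | 0 => 0
    | 1 => -z₂ / 2
    | 2 => z₃ / 2
    | 3 => (z₂ ^ 2 - z₄) / 4
    | _ => -(z₂ * z₃) / 2
  have h := eq_zero_of_abs_sum_le 5 (fun m => I m - t m) (D₁ + D₂ / 2) δ hδ ?_
  · exact ⟨sub_eq_zero.1 (h 0 (by norm_num)), sub_eq_zero.1 (h 1 (by norm_num)),
      sub_eq_zero.1 (h 2 (by norm_num)), sub_eq_zero.1 (h 3 (by norm_num)),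
      sub_eq_zero.1 (h 4 (by norm_num))⟩
  intro ε hε hεδ
  have hK := hD₁ ε hε.le (hεδ.trans hδ1)
  have hP := hD₂ ε _ hε hεδ (tendsto_prod_cubeRoot' hε (hεδ.trans hδ1))
  set K := ∫ u in Ioi (0 : ℝ), (Real.exp (-1 * ε * Real.log (1 + Real.exp (-u))) - 1) *
        (Complex.exp (cubeRoot * (ε * u : ℝ))).re with hKdef
  have e : 1 + 2 * ε * K - (1 - z₂ * ε ^ 2 + z₃ * ε ^ 3 + (z₂ ^ 2 / 2 - z₄ / 2) * ε ^ 4 -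
      z₂ * z₃ * ε ^ 5) = 2 * ε * (K - ∑ m ∈ Finset.range 5, ε ^ m * t m) := by
    simp only [Finset.sum_range_succ, Finset.sum_range_zero, t]
    ring
  rw [e, abs_mul, abs_of_pos (by positivity)] at hP
  have hP2 : |K - ∑ m ∈ Finset.range 5, ε ^ m * t m| ≤ D₂ / 2 * ε ^ 5 := by
    refine le_of_mul_le_mul_left (hP.trans_eq ?_) (show 0 < 2 * ε by positivity)
    ring
  have e2 : ∑ m ∈ Finset.range 5, ε ^ m * (I m - t m) =
      (K - ∑ m ∈ Finset.range 5, ε ^ m * t m) - (K - ∑ m ∈ Finset.range 5, ε ^ m * I m) := by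
    simp only [mul_sub, Finset.sum_sub_distrib]
    ring
  rw [e2]
  refine (abs_sub _ _).trans ?_
  rw [add_mul]
  linarith

/-- Coefficients of the asymptotic expansion of `powerMeanIntegral`. -/
noncomputable def powerMeanCoeff : ℕ → ℝ
  | 0 => 3 / 4
  | m + 1 => 2 * ∫ u in Ioi (0 : ℝ), coeffDensity 1 sigmoidCoeff m u

lemma hasAsymptoticExpansion_powerMeanIntegral :
    HasAsymptoticExpansion powerMeanIntegral powerMeanCoeff := by
  intro N
  obtain ⟨C, hC⟩ := exists_sigmoid_taylor_bound
  have hcs := _root_.continuous_sigmoid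
  obtain ⟨D, hD⟩ := exists_abs_integral_sub_sum_le (σ := 1) (by simp)
    (g := fun s => Real.sigmoid s ^ 2 * (1 - Real.sigmoid s)) (by fun_prop) hC N
  -- The prefactor `2 / n` raises the order by one, so `N` terms of the inner expansion already give
  -- an error `O(n^(-N-1))`.
  have hO : (fun n : ℝ => powerMeanIntegral n - ∑ i ∈ Finset.range (N + 1), powerMeanCoeff i / n ^ i)
      =O[atTop] fun n : ℝ => 1 / n ^ (N + 1) := by
    refine IsBigO.of_bound (2 * D) ?_
    filter_upwards [eventually_ge_atTop 1] with n hn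
    have hn0 : 0 < n := by linarith
    have hb := hD n⁻¹ (inv_nonneg.2 hn0.le) (inv_le_one_of_one_le₀ hn)
    have e : powerMeanIntegral n - ∑ i ∈ Finset.range (N + 1), powerMeanCoeff i / n ^ i =
        2 * n⁻¹ * ((∫ u in Ioi (0 : ℝ),
          (Real.exp (1 * n⁻¹ * Real.log (1 + Real.exp (-u))) - 1) *
            (Real.sigmoid (n⁻¹ * u) ^ 2 * (1 - Real.sigmoid (n⁻¹ * u)))) -
          ∑ m ∈ Finset.range N, n⁻¹ ^ m *
            ∫ u in Ioi (0 : ℝ), coeffDensity 1 sigmoidCoeff m u) := by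
      rw [powerMeanIntegral_eq hn, Finset.sum_range_succ', mul_sub, Finset.mul_sum]
      have : ∑ k ∈ Finset.range N, powerMeanCoeff (k + 1) / n ^ (k + 1) =
          ∑ m ∈ Finset.range N, 2 * n⁻¹ * (n⁻¹ ^ m *
            ∫ u in Ioi (0 : ℝ), coeffDensity 1 sigmoidCoeff m u) :=
        Finset.sum_congr rfl fun m _ => by
          rw [powerMeanCoeff, inv_pow, pow_succ]
          field_simp
      rw [this]
      simp only [powerMeanCoeff, pow_zero, div_one]
      ring
    rw [e, Real.norm_eq_abs, Real.norm_eq_abs, abs_mul, abs_of_pos (by positivity),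
      abs_of_pos (show 0 < 1 / n ^ (N + 1) by positivity)]
    refine (mul_le_mul_of_nonneg_left hb (by positivity)).trans_eq ?_
    rw [inv_pow, pow_succ]
    field_simp
  refine hO.trans_isLittleO ?_
  have : (fun n : ℝ => 1 / n ^ (N + 1)) = fun n => n⁻¹ * (1 / n ^ N) := by
    funext n
    rw [pow_succ, one_div, mul_inv, one_div, mul_comm]
  rw [this]
  have h1 : (fun n : ℝ => n⁻¹) =o[atTop] fun _ => (1 : ℝ) :=
    (isLittleO_one_iff ℝ).2 tendsto_inv_atTop_zero
  simpa using h1.mul_isBigO (isBigO_refl (fun n : ℝ => 1 / n ^ N) atTop)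

lemma powerMeanCoeff_succ {m : ℕ} (hm : m < 5) : powerMeanCoeff (m + 1) =
    (-1) ^ m / 4 * ∫ u in Ioi (0 : ℝ), coeffDensity (-1) cubeRootCoeff m u := by
  rw [powerMeanCoeff]
  simp_rw [coeffDensity_sigmoid_eq hm]
  rw [integral_const_mul]
  ring

theorem theorem1 :
    ∃ c : ℕ → ℝ, HasAsymptoticExpansion powerMeanIntegral c ∧
      c 0 = 3 / 4 ∧
      c 1 = 0 ∧
      c 2 = Real.pi ^ 2 / 48 ∧
      (c 3 : ℂ) = riemannZeta 3 / 8 ∧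
      c 4 = -(Real.pi ^ 4 / 960) ∧
      (c 5 : ℂ) = -(riemannZeta 3 * (Real.pi : ℂ) ^ 2 / 48) := by
  have h₃ : HasSum (fun n : ℕ => 1 / (n : ℝ) ^ 3) (∑' n : ℕ, 1 / (n : ℝ) ^ 3) :=
    (Real.summable_one_div_nat_pow.2 (by norm_num)).hasSum
  have hz : riemannZeta 3 = ((∑' n : ℕ, 1 / (n : ℝ) ^ 3 : ℝ) : ℂ) := by
    have := zeta_nat_eq_tsum_of_gt_one (k := 3) (by norm_num)
    push_cast at this ⊢
    exact this
  obtain ⟨i0, i1, i2, i3, i4⟩ :=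
    integral_coeffDensity_cubeRoot hasSum_zeta_two h₃ hasSum_zeta_four
  refine ⟨powerMeanCoeff, hasAsymptoticExpansion_powerMeanIntegral, rfl, ?_, ?_, ?_, ?_, ?_⟩
  · rw [powerMeanCoeff_succ (by norm_num), i0]; simp
  · rw [powerMeanCoeff_succ (by norm_num), i1]; ring
  · rw [powerMeanCoeff_succ (by norm_num), i2, hz]; push_cast; ring
  · rw [powerMeanCoeff_succ (by norm_num), i3]; ring
  · rw [powerMeanCoeff_succ (by norm_num), i4, hz]; push_cast; ring
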